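/- Throughout, $|\cdot|$ on sets denotes $n$-dimensional Lebesgue (outer) measure $\mathcal L^n$, and "measurable", "a.e." refer to it. Let $\Omega\subset\mathbb{R}^n$ be a bounded domain (a nonempty, open, connected, bounded set). A measurable map $h:\Omega\to\mathbb{R}^n$ is *approximately differentiable* at $x\in\Omega$ if there are a measurable set $E$ of Lebesgue density $1$ at $x$ and a linear map $L:\mathbb{R}^n\to\mathbb{R}^n$ with $$\lim_{y\to x,\;y\in E}\frac{|h(x)-h(y)-L(x-y)|}{|x-y|}=0 ;$$ then $L$ is unique, and one writes $D_{\mathrm a}h(x):=L$ and $J_{\mathrm a}h(x):=\det D_{\mathrm a}h(x)$. The map $h$ is *injective a.e.* if $h|_{\Omega\setminus N}$ is injective for some $N\subset\Omega$ with $|N|=0$, and $h$ *satisfies the Lusin condition (N)* if $|h(A)|=0$ for every $A\subset\Omega$ with $|A|=0$. Write $E\Subset\Omega$ if $\overline{E}$ is a compact subset of $\Omega$. **Theorem.** Let $f_k:\Omega\to\mathbb{R}^n$ ($k\in\mathbb{N}$) be continuous, injective a.e. and approximately differentiable a.e. Let $f:\Omega\to\mathbb{R}^n$ satisfy the Lusin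 condition (N) and be approximately differentiable a.e., with $J_{\mathrm a}f$ locally integrable on $\Omega$. Assume that $D_{\mathrm a}f_k\to D_{\mathrm a}f$ in $\mathcal L^n$-measure on $\Omega$, and that for every Borel set $E\Subset\Omega$ $$\lim_{k\to\infty}|f_k(E)|=|f(E)| .$$ Then $J_{\mathrm a}f_k\to J_{\mathrm a}f$ in $L^1_{loc}(\Omega)$; that is, each $J_{\mathrm a}f_k$ is locally integrable on $\Omega$ and $\int_K|J_{\mathrm a}f_k-J_{\mathrm a}f|\,dx\to0$ as $k\to\infty$ for every compact $K\subset\Omega$. -/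

import Mathlib

open MeasureTheory Filter Set Topology Metric
open scoped ENNReal Pointwise

/-- `ℝⁿ` with its Euclidean norm; `volume` is `n`-dimensional Lebesgue measure. -/
abbrev Rn (n : ℕ) : Type := EuclideanSpace ℝ (Fin n)

/-- `x` is a point of (Lebesgue) density `1` of the set `E`. -/
def HasDensityOneAt {n : ℕ} (E : Set (Rn n)) (x : Rn n) : Prop :=
  Tendsto (fun r : ℝ => volume (E ∩ closedBall x r) / volume (closedBall x r)) (𝓝[>] 0) (𝓝 1)

/-- `L` is an approximate derivative of `f` at `x`: there is a Lebesgue measurable set `E` of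
density `1` at `x` with `|f y - f x - L (y - x)| / |y - x| → 0` as `y → x`, `y ∈ E`.

A map on an open set `Ω` is represented by a map on `ℝⁿ` whose values outside `Ω` are irrelevant:
for `x ∈ Ω` this notion depends only on the values of `f` near `x`. -/
def HasApproxFDerivAt {n : ℕ} (f : Rn n → Rn n) (L : Rn n →L[ℝ] Rn n) (x : Rn n) : Prop :=
  ∃ E : Set (Rn n), NullMeasurableSet E volume ∧ HasDensityOneAt E x ∧ HasFDerivWithinAt f L E x

/-- `f` is approximately differentiable at `x`. -/
def ApproxDifferentiableAt {n : ℕ} (f : Rn n → Rn n) (x : Rn n) : Prop :=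
  ∃ L : Rn n →L[ℝ] Rn n, HasApproxFDerivAt f L x

open Classical in
/-- The approximate derivative `D_a f (x)`, with the value `0` where `f` is not approximately
differentiable. It is well defined by `HasApproxFDerivAt.unique` below. -/
noncomputable def approxFDeriv {n : ℕ} (f : Rn n → Rn n) (x : Rn n) : Rn n →L[ℝ] Rn n :=
  if h : ApproxDifferentiableAt f x then Classical.choose h else 0

/-- The approximate Jacobian `J_a f (x) = det D_a f (x)`. -/
noncomputable def approxJacobian {n : ℕ} (f : Rn n → Rn n) (x : Rn n) : ℝ :=
  (approxFDeriv f x).det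

/-- `f : Ω → ℝⁿ` is (Lebesgue) measurable and approximately differentiable at almost every point
of `Ω`. -/
def ApproxDifferentiableAE {n : ℕ} (f : Rn n → Rn n) (Ω : Set (Rn n)) : Prop :=
  AEMeasurable f (volume.restrict Ω) ∧ ∀ᵐ x ∂(volume.restrict Ω), ApproxDifferentiableAt f x

/-- `f : Ω → ℝⁿ` is injective almost everywhere: injective on the complement in `Ω` of some set of
measure zero. -/
def InjectiveAE {n : ℕ} (f : Rn n → Rn n) (Ω : Set (Rn n)) : Prop :=
  ∃ N : Set (Rn n), N ⊆ Ω ∧ volume N = 0 ∧ InjOn f (Ω \ N)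

/-- The Lusin condition (N) for `f : Ω → ℝⁿ`: null subsets of `Ω` have null images. -/
def LusinN {n : ℕ} (f : Rn n → Rn n) (Ω : Set (Rn n)) : Prop :=
  ∀ A : Set (Rn n), A ⊆ Ω → volume A = 0 → volume (f '' A) = 0

/-- `E ⋐ Ω`: the closure of `E` is a compact subset of `Ω`. -/
def CompactlyContained {n : ℕ} (E Ω : Set (Rn n)) : Prop :=
  IsCompact (closure E) ∧ closure E ⊆ Ω

/-- `g k → g` in `L¹_loc(Ω)`, where `Ω` is open: all these functions are locally integrable on `Ω`
and `∫_K |g k - g| → 0` for every compact `K ⊆ Ω`. -/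
def TendstoInL1Loc {n : ℕ} (g : ℕ → Rn n → ℝ) (g' : Rn n → ℝ) (Ω : Set (Rn n)) : Prop :=
  (∀ k, LocallyIntegrableOn (g k) Ω volume) ∧ LocallyIntegrableOn g' Ω volume ∧
    ∀ K : Set (Rn n), K ⊆ Ω → IsCompact K →
      Tendsto (fun k => ∫⁻ x in K, ‖g k x - g' x‖ₑ) atTop (𝓝 0)

/-- The intersection of two measurable sets of density `1` at `x` has density `1` at `x`. -/
theorem HasDensityOneAt.inter {n : ℕ} {E F : Set (Rn n)} {x : Rn n} (hE : HasDensityOneAt E x)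
    (hF : HasDensityOneAt F x) (hFm : NullMeasurableSet F volume) :
    HasDensityOneAt (E ∩ F) x := by
  have key : ∀ r : ℝ, 0 < r →
      volume (E ∩ closedBall x r) / volume (closedBall x r)
        + volume (F ∩ closedBall x r) / volume (closedBall x r) - 1 ≤
      volume (E ∩ F ∩ closedBall x r) / volume (closedBall x r) := by
    intro r hr
    have h0 : volume (closedBall x r) ≠ 0 := (measure_closedBall_pos volume x hr).ne'
    have ht : volume (closedBall x r) ≠ ∞ := measure_closedBall_lt_top.ne
    rw [tsub_le_iff_right, ← ENNReal.div_self h0 ht, ← ENNReal.add_div, ← ENNReal.add_div]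
    refine ENNReal.div_le_div_right ?_ _
    have h1 : volume (E ∩ closedBall x r) ≤
        volume (E ∩ F ∩ closedBall x r) + volume (closedBall x r \ F) := by
      refine (measure_mono ?_).trans (measure_union_le _ _)
      rintro y ⟨hy1, hy2⟩
      by_cases hy : y ∈ F
      · exact Or.inl ⟨⟨hy1, hy⟩, hy2⟩
      · exact Or.inr ⟨hy2, hy⟩
    have h2 := measure_inter_add_sdiff₀ (μ := volume) (closedBall x r) hFm
    calc volume (E ∩ closedBall x r) + volume (F ∩ closedBall x r)
        ≤ volume (E ∩ F ∩ closedBall x r) + volume (closedBall x r \ F)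
            + volume (F ∩ closedBall x r) := by gcongr
      _ = volume (E ∩ F ∩ closedBall x r) + volume (closedBall x r) := by
          rw [← h2, inter_comm F, add_assoc, add_comm (volume (closedBall x r \ F))]
  have hlim : Tendsto (fun r : ℝ => volume (E ∩ closedBall x r) / volume (closedBall x r)
        + volume (F ∩ closedBall x r) / volume (closedBall x r) - 1) (𝓝[>] 0) (𝓝 1) := by
    have := ENNReal.Tendsto.sub (Tendsto.add hE hF) (tendsto_const_nhds (x := (1 : ℝ≥0∞)))
      (Or.inr ENNReal.one_ne_top)
    simpa using this
  refine tendsto_of_tendsto_of_tendsto_of_le_of_le' hlim tendsto_const_nhds ?_ ?_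
  · filter_upwards [self_mem_nhdsWithin] with r hr using key r hr
  · exact Eventually.of_forall fun r => ENNReal.div_le_of_le_mul (by
      rw [one_mul]; exact measure_mono inter_subset_right)

/-- Approximate derivatives are unique. -/
theorem HasApproxFDerivAt.unique {n : ℕ} {f : Rn n → Rn n} {L M : Rn n →L[ℝ] Rn n} {x : Rn n}
    (hL : HasApproxFDerivAt f L x) (hM : HasApproxFDerivAt f M x) : L = M := by
  obtain ⟨E, -, hE, hfE⟩ := hL
  obtain ⟨F, hFm, hF, hfF⟩ := hM
  have hd := hE.inter hF hFm
  have hD : HasFDerivWithinAt (fun y => f y - f y) (L - M) (E ∩ F) x :=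
    (hfE.mono inter_subset_left).sub (hfF.mono inter_subset_right)
  simp only [sub_self] at hD
  rw [← sub_eq_zero]
  ext1 z
  set A := L - M with hA
  suffices H : ∀ ε : ℝ, 0 < ε → ‖A z‖ ≤ ε * (‖z‖ + ε) + ‖A‖ * ε by
    have : Tendsto (fun ε : ℝ => ε * (‖z‖ + ε) + ‖A‖ * ε) (𝓝[>] 0)
        (𝓝 (0 * (‖z‖ + 0) + ‖A‖ * 0)) :=
      Tendsto.mono_left (Continuous.tendsto (by fun_prop) 0) nhdsWithin_le_nhds
    have h0 : ‖A z‖ ≤ 0 * (‖z‖ + 0) + ‖A‖ * 0 := by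
      refine le_of_tendsto_of_tendsto tendsto_const_nhds this ?_
      filter_upwards [self_mem_nhdsWithin] with ε hε using H ε hε
    simpa using h0
  intro ε εpos
  have B₁ := Measure.eventually_nonempty_inter_smul_of_density_one volume (E ∩ F) x hd
    (closedBall z ε) measurableSet_closedBall (measure_closedBall_pos volume z εpos).ne'
  obtain ⟨ρ, ρpos, hρ⟩ := mem_nhdsWithin_iff.1 (hD.isLittleO.def εpos)
  have B₂ : ∀ᶠ r in 𝓝[>] (0 : ℝ), {x} + r • closedBall z ε ⊆ ball x ρ :=
    nhdsWithin_le_nhds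
      (eventually_singleton_add_smul_subset isBounded_closedBall (ball_mem_nhds x ρpos))
  obtain ⟨r, ⟨y, ys, hy⟩, rρ, rpos⟩ := (B₁.and (B₂.and self_mem_nhdsWithin)).exists
  have rpos' : 0 < r := rpos
  have hb := hρ ⟨rρ hy, ys⟩
  obtain ⟨a, az, ya⟩ : ∃ a, a ∈ closedBall z ε ∧ y = x + r • a := by
    simp only [mem_smul_set, image_add_left, mem_preimage, singleton_add] at hy
    rcases hy with ⟨a, az, ha⟩
    exact ⟨a, az, by simp only [ha, add_neg_cancel_left]⟩
  have h1 : ‖A a‖ ≤ ε * ‖a‖ := by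
    have h2 : ‖A (r • a)‖ ≤ ε * ‖r • a‖ := by simpa [ya] using hb
    rw [map_smul, norm_smul, norm_smul, Real.norm_of_nonneg rpos'.le] at h2
    nlinarith
  have h3 : ‖a‖ ≤ ‖z‖ + ε := by
    have := norm_le_norm_add_norm_sub' a z
    have := mem_closedBall_iff_norm.1 az
    linarith
  have h4 : ‖z - a‖ ≤ ε := by
    rw [norm_sub_rev]; exact mem_closedBall_iff_norm.1 az
  calc ‖A z‖ = ‖A a + A (z - a)‖ := by rw [← map_add]; congr 2; abel
    _ ≤ ‖A a‖ + ‖A (z - a)‖ := norm_add_le _ _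
    _ ≤ ε * (‖z‖ + ε) + ‖A‖ * ε := by
      refine add_le_add (h1.trans (by gcongr)) ((A.le_opNorm _).trans (by gcongr))

theorem HasApproxFDerivAt.approxFDeriv_eq {n : ℕ} {f : Rn n → Rn n} {L : Rn n →L[ℝ] Rn n}
    {x : Rn n} (hL : HasApproxFDerivAt f L x) : approxFDeriv f x = L := by
  have h : ApproxDifferentiableAt f x := ⟨L, hL⟩
  rw [approxFDeriv, dif_pos h]
  exact (Classical.choose_spec h).unique hL

/-! On a compact `K ⊆ Ω` two one-sided area inequalities suffice. Injectivity a.e. gives `∫_K |J_a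
f_k| ≤ |f_k(K)|`: images of null sets can only enlarge the right side. Condition (N) gives `|g(K)| ≤
∫_K |J_a g|`: multiplicity can only enlarge the right side. As `|f_k(K)| → |g(K)|`, the `L¹(K)`
norms of `J_a f_k` are asymptotically at most that of `J_a g`. Along a subsequence the derivatives,
hence their determinants, converge a.e., and a Scheffé argument turns this norm bound into `L¹`
convergence.

The area inequalities reduce to Mathlib's area theorems once `Ω` is split, up to a null set, into
measurable pieces along which the map is differentiable (`ApproxDifferentiableAE.exists_partition`).
Those pieces come from a countable family of Lipschitz maps agreeing with `f` wherever it is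
approximately differentiable, together with Rademacher's theorem and density points. -/

/-! ### Lipschitz pieces of an approximately differentiable map -/

/-- Near a point of approximate differentiability, the set where the difference quotient is large
occupies an arbitrarily small proportion of small balls. -/
theorem HasApproxFDerivAt.exists_measure_lt_dist_le {n : ℕ} {f : Rn n → Rn n}
    {L : Rn n →L[ℝ] Rn n} {x : Rn n} (h : HasApproxFDerivAt f L x) {c : ℝ≥0∞} (hc : c ≠ 0) :
    ∃ M m : ℕ, ∀ r : ℝ, 0 < r → r < 1 / (m + 1) →
      volume {y ∈ closedBall x r | M * dist y x < dist (f y) (f x)} ≤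
        c * volume (closedBall x r) := by
  obtain ⟨E, hEm, hE, hf⟩ := h
  -- On `E` near `x` the linearization error is at most `dist y x`, so the slope there is at most
  -- `‖L‖ + 1` and the bad points avoid `E`.
  obtain ⟨M, hM⟩ := exists_nat_gt (‖L‖ + 1)
  obtain ⟨ρ, ρpos, hρ⟩ := mem_nhdsWithin_iff.1 (hf.isLittleO.def one_pos)
  have hev : ∀ᶠ r in 𝓝[>] (0 : ℝ), 1 ≤ volume (E ∩ closedBall x r) / volume (closedBall x r) + c := by
    have h1 : (1 : ℝ≥0∞) < 1 + c := ENNReal.lt_add_right ENNReal.one_ne_top hc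
    filter_upwards [(hE.add_const c).eventually_const_lt h1] with r hr using hr.le
  obtain ⟨δ, δpos, hδ⟩ := (mem_nhdsGT_iff_exists_Ioo_subset).1 hev
  obtain ⟨m, hm⟩ := exists_nat_one_div_lt (lt_min ρpos (mem_Ioi.1 δpos))
  refine ⟨M, m, fun r hr0 hrm => ?_⟩
  have hrρ : r < ρ := (hrm.trans hm).trans_le (min_le_left _ _)
  have hrδ : r < δ := (hrm.trans hm).trans_le (min_le_right _ _)
  have h0 : volume (closedBall x r) ≠ 0 := (measure_closedBall_pos volume x hr0).ne'
  have ht : volume (closedBall x r) ≠ ∞ := measure_closedBall_lt_top.ne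
  have hsub : {y ∈ closedBall x r | M * dist y x < dist (f y) (f x)} ⊆ closedBall x r \ E := by
    rintro y ⟨hy, hlt⟩
    refine ⟨hy, fun hyE => hlt.not_ge ?_⟩
    have h1 := hρ ⟨mem_ball.2 ((mem_closedBall.1 hy).trans_lt hrρ), hyE⟩
    simp only [mem_ofPred_eq, one_mul] at h1
    rw [dist_eq_norm, dist_eq_norm]
    have h2 := L.le_opNorm (y - x)
    have h3 : ‖f y - f x‖ ≤ ‖f y - f x - L (y - x)‖ + ‖L (y - x)‖ := by
      simpa using norm_add_le (f y - f x - L (y - x)) (L (y - x))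
    nlinarith [norm_nonneg (y - x)]
  refine (measure_mono hsub).trans ?_
  have h1 : 1 ≤ volume (E ∩ closedBall x r) / volume (closedBall x r) + c := hδ ⟨hr0, hrδ⟩
  have h2 := measure_inter_add_sdiff₀ (μ := volume) (closedBall x r) hEm
  have h3 : volume (closedBall x r) ≤ volume (E ∩ closedBall x r) + c * volume (closedBall x r) := by
    calc volume (closedBall x r) = 1 * volume (closedBall x r) := (one_mul _).symm
      _ ≤ (volume (E ∩ closedBall x r) / volume (closedBall x r) + c) * volume (closedBall x r) := by
        gcongr
      _ = _ := by rw [add_mul, ENNReal.div_mul_cancel h0 ht]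
  rw [← h2, inter_comm E] at h3
  have h4 : volume (closedBall x r ∩ E) ≠ ∞ := measure_ne_top_of_subset inter_subset_left ht
  rw [h2] at h3
  exact (ENNReal.add_le_add_iff_left h4).1 (h2 ▸ h3)

/-- If the sets where the difference quotient exceeds `M` occupy a small proportion of the balls of
radius `dist x x'` around `x` and `x'`, then `f` does not stretch the pair `x, x'` by more than
`2 * M`. -/
theorem dist_le_of_measure_lt_dist_le {n : ℕ} {f : Rn n → Rn n} {x x' : Rn n} (hne : x ≠ x') {M : ℝ}
    (hM : 0 ≤ M)
    (h : ∀ z ∈ ({x, x'} : Set (Rn n)),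
      volume {y ∈ closedBall z (dist x x') | M * dist y z < dist (f y) (f z)} ≤
        ENNReal.ofReal ((1 / 2) ^ n / 4) * volume (closedBall z (dist x x'))) :
    dist (f x) (f x') ≤ 2 * M * dist x x' := by
  set r := dist x x' with hr
  have hr0 : 0 < r := dist_pos.2 hne
  set w := midpoint ℝ x x' with hw
  have hwx : dist w x = r / 2 := by rw [hw, dist_midpoint_left, Real.norm_ofNat]; ring
  have hwx' : dist w x' = r / 2 := by rw [hw, dist_midpoint_right, Real.norm_ofNat]; ring
  have hv : ∀ z : Rn n, volume (closedBall z r) = volume (closedBall x r) := fun z => by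
    rw [Measure.addHaar_closedBall volume z hr0.le, Measure.addHaar_closedBall volume x hr0.le]
  have hvw : volume (closedBall w (r / 2)) =
      ENNReal.ofReal ((1 / 2) ^ n) * volume (closedBall x r) := by
    rw [Measure.addHaar_closedBall volume w (by positivity),
      Measure.addHaar_closedBall volume x hr0.le, ← mul_assoc, ← ENNReal.ofReal_mul (by positivity),
      finrank_euclideanSpace_fin, ← mul_pow]
    congr 3
    ring
  set v := volume (closedBall x r)
  have h0 : v ≠ 0 := (measure_closedBall_pos volume x hr0).ne'
  have ht : v ≠ ∞ := measure_closedBall_lt_top.ne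
  set B := fun z => {y ∈ closedBall z r | M * dist y z < dist (f y) (f z)} with hB
  -- The ball of radius `r / 2` at the midpoint lies in both balls of radius `r` and has `(1 / 2) ^
  -- n` of their volume. Each bad set takes at most a quarter of that, so some `y` in it is good for
  -- both points.
  have hlt : volume (B x ∪ B x') < volume (closedBall w (r / 2)) := by
    calc volume (B x ∪ B x') ≤ volume (B x) + volume (B x') := measure_union_le _ _
      _ ≤ ENNReal.ofReal ((1 / 2) ^ n / 4) * v + ENNReal.ofReal ((1 / 2) ^ n / 4) * v := by
        gcongr
        · exact h x (by simp)
        · exact (h x' (by simp)).trans_eq (by rw [hv])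
      _ = ENNReal.ofReal ((1 / 2) ^ n / 2) * v := by
        rw [← add_mul, ← ENNReal.ofReal_add (by positivity) (by positivity)]
        congr 2; ring
      _ < ENNReal.ofReal ((1 / 2) ^ n) * v := by
        refine ENNReal.mul_lt_mul_left h0 ht ?_
        exact (ENNReal.ofReal_lt_ofReal_iff (by positivity)).2 (half_lt_self (by positivity))
      _ = _ := hvw.symm
  obtain ⟨y, hyw, hy⟩ : ∃ y ∈ closedBall w (r / 2), y ∉ B x ∪ B x' := by
    by_contra! hcon
    exact hlt.not_ge (measure_mono hcon)
  rw [mem_closedBall] at hyw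
  have hyx : dist y x ≤ r := (dist_triangle y w x).trans (by linarith)
  have hyx' : dist y x' ≤ r := (dist_triangle y w x').trans (by linarith)
  simp only [hB, mem_union, mem_ofPred_eq, mem_closedBall, not_or, not_and, not_lt] at hy
  calc dist (f x) (f x') ≤ dist (f y) (f x) + dist (f y) (f x') := dist_triangle_left _ _ _
    _ ≤ M * r + M * r := add_le_add ((hy.1 hyx).trans (by gcongr)) ((hy.2 hyx').trans (by gcongr))
    _ = 2 * M * r := by ring

/-- An arbitrary map coincides, at each of its points of approximate differentiability, with one of
countably many Lipschitz maps. -/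
theorem exists_lipschitz_seq_of_approxDifferentiableAt {n : ℕ} (f : Rn n → Rn n) :
    ∃ F : ℕ → Rn n → Rn n, (∀ j, ∃ C, LipschitzWith C (F j)) ∧
      ∀ x, ApproxDifferentiableAt f x → ∃ j, f x = F j x := by
  -- The index holds a slope, a scale and a centre. Halving the radius puts any two points of a
  -- piece within the scale `1 / (p.2.1 + 1)`. These pieces need not be measurable.
  let A : ℕ × ℕ × ℕ → Set (Rn n) := fun p =>
    {x ∈ ball (TopologicalSpace.denseSeq (Rn n) p.2.2) (1 / (2 * (p.2.1 + 1))) |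
      ∀ r : ℝ, 0 < r → r < 1 / (p.2.1 + 1) →
        volume {y ∈ closedBall x r | p.1 * dist y x < dist (f y) (f x)} ≤
          ENNReal.ofReal ((1 / 2) ^ n / 4) * volume (closedBall x r)}
  have hA : ∀ p, LipschitzOnWith (2 * p.1) f (A p) := by
    refine fun p => LipschitzOnWith.of_dist_le_mul fun x hx x' hx' => ?_
    rcases eq_or_ne x x' with rfl | hne
    · simp
    have hd : dist x x' < 1 / (p.2.1 + 1) := by
      have h1 := mem_ball.1 hx.1
      have h2 := mem_ball.1 hx'.1
      refine ((dist_triangle_right x x' _).trans_lt (add_lt_add h1 h2)).trans_eq ?_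
      field_simp
      norm_num
    refine (dist_le_of_measure_lt_dist_le hne (M := p.1) (by positivity) ?_).trans_eq (by push_cast; rfl)
    rintro z (rfl | rfl)
    · exact hx.2 _ (dist_pos.2 hne) hd
    · exact hx'.2 _ (dist_pos.2 hne) hd
  choose G hG hGf using fun p => (hA p).extend_finite_dimension
  obtain ⟨e, he⟩ := exists_surjective_nat (ℕ × ℕ × ℕ)
  refine ⟨fun j => G (e j), fun j => ⟨_, hG (e j)⟩, fun x ⟨L, hL⟩ => ?_⟩
  obtain ⟨M, m, h⟩ := hL.exists_measure_lt_dist_le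
    (c := ENNReal.ofReal ((1 / 2) ^ n / 4)) (ENNReal.ofReal_pos.2 (by positivity)).ne'
  obtain ⟨i, hi⟩ := (TopologicalSpace.denseRange_denseSeq (Rn n)).exists_dist_lt x
    (ε := 1 / (2 * ((m : ℝ) + 1))) (by positivity)
  obtain ⟨j, hj⟩ := he (M, m, i)
  exact ⟨j, hGf (e j) (by rw [hj]; exact ⟨hi, h⟩)⟩

/-- If `f` agrees with a Lipschitz map `F` on a measurable set `S`, then at almost every point of
`S` the derivative of `F` is an approximate derivative of `f`. -/
theorem LipschitzWith.ae_hasApproxFDerivAt_of_eqOn {n : ℕ} {f F : Rn n → Rn n} {C : NNReal}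
    (hF : LipschitzWith C F) {S : Set (Rn n)} (hS : NullMeasurableSet S volume)
    (hfF : EqOn f F S) :
    ∀ᵐ x ∂(volume.restrict S), HasFDerivAt F (fderiv ℝ F x) x ∧
      HasApproxFDerivAt f (fderiv ℝ F x) x := by
  -- Almost every point of `S` is a density point, and Rademacher's theorem differentiates `F`.
  filter_upwards [Besicovitch.ae_tendsto_measure_inter_div volume S, ae_restrict_mem₀ hS,
    ae_restrict_of_ae hF.ae_differentiableAt] with x hx hxS hxd
  exact ⟨hxd.hasFDerivAt, S, hS, hx, hxd.hasFDerivAt.hasFDerivWithinAt.congr hfF (hfF hxS)⟩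

/-- A map that is approximately differentiable a.e. is differentiable along each of countably many
disjoint measurable sets covering almost all of its domain, with derivative the approximate
derivative. -/
theorem ApproxDifferentiableAE.exists_partition {n : ℕ} {f : Rn n → Rn n} {Ω : Set (Rn n)}
    (hf : ApproxDifferentiableAE f Ω) (hΩ : MeasurableSet Ω) :
    ∃ B : ℕ → Set (Rn n), (∀ j, MeasurableSet (B j)) ∧ Pairwise (Function.onFun Disjoint B) ∧
      (∀ j, B j ⊆ Ω) ∧ volume (Ω \ ⋃ j, B j) = 0 ∧
      ∀ j, ∀ x ∈ B j, HasFDerivWithinAt f (approxFDeriv f x) (B j) x := by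
  obtain ⟨F, hFL, hF⟩ := exists_lipschitz_seq_of_approxDifferentiableAt f
  choose C hC using hFL
  -- Measurability of `f` enters here, making the coincidence sets measurable up to null sets.
  have hS : ∀ j, NullMeasurableSet ({x | f x = F j x} ∩ Ω) volume := fun j => by
    have := nullMeasurableSet_eq_fun (μ := volume.restrict Ω) hf.1
      (hC j).continuous.measurable.aemeasurable
    exact (nullMeasurableSet_restrict hΩ.nullMeasurableSet).1 this
  have hae : ∀ j, ∀ᵐ x, x ∈ {x | f x = F j x} ∩ Ω → HasFDerivAt (F j) (approxFDeriv f x) x := by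
    intro j
    have h1 := (hC j).ae_hasApproxFDerivAt_of_eqOn (hS j) (f := f) fun x hx => hx.1
    filter_upwards [(ae_restrict_iff'₀ (hS j)).1 h1] with x hx hxS
    rw [(hx hxS).2.approxFDeriv_eq]
    exact (hx hxS).1
  -- Discarding a null set yields Borel pieces on which differentiability holds at every point, as
  -- the area theorems require.
  have hex : ∀ j, ∃ T ⊆ ({x | f x = F j x} ∩ Ω) ∩ {x | HasFDerivAt (F j) (approxFDeriv f x) x},
      MeasurableSet T ∧ T =ᵐ[volume] ({x | f x = F j x} ∩ Ω : Set (Rn n)) := by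
    intro j
    have heq : (({x | f x = F j x} ∩ Ω) ∩ {x | HasFDerivAt (F j) (approxFDeriv f x) x} : Set (Rn n))
        =ᵐ[volume] ({x | f x = F j x} ∩ Ω : Set (Rn n)) := by
      refine eventuallyEq_set.2 ?_
      filter_upwards [hae j] with x hx using ⟨fun h => h.1, fun h => ⟨h, hx h⟩⟩
    obtain ⟨T, hT, hTm, hTe⟩ := ((hS j).congr heq.symm).exists_measurable_subset_ae_eq
    exact ⟨T, hT, hTm, hTe.trans heq⟩
  choose T hT hTm hTe using hex
  refine ⟨disjointed T, fun j => .disjointed hTm j, disjoint_disjointed T,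
    fun j x hx => (hT j (disjointed_subset T j hx)).1.2, ?_, fun j x hx => ?_⟩
  · rw [iUnion_disjointed]
    have h2 := (ae_restrict_iff' hΩ).1 hf.2
    have h3 : ∀ᵐ x, ∀ j, x ∈ T j ↔ x ∈ {x | f x = F j x} ∩ Ω :=
      ae_all_iff.2 fun j => eventuallyEq_set.1 (hTe j)
    refine measure_mono_null ?_ (ae_iff.1 (h2.and h3))
    rintro x ⟨hxΩ, hxT⟩ ⟨hx1, hx2⟩
    obtain ⟨j, hj⟩ := hF x (hx1 hxΩ)
    exact hxT (mem_iUnion.2 ⟨j, (hx2 j).2 ⟨hj, hxΩ⟩⟩)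
  · have h1 := hT j (disjointed_subset T j hx)
    exact (h1.2.hasFDerivWithinAt).congr (fun y hy => (hT j (disjointed_subset T j hy)).1.1) h1.1.1

/-- The approximate Jacobian of an a.e. approximately differentiable map is measurable. -/
theorem ApproxDifferentiableAE.aemeasurable_approxJacobian {n : ℕ} {f : Rn n → Rn n}
    {Ω : Set (Rn n)} (hf : ApproxDifferentiableAE f Ω) (hΩ : MeasurableSet Ω) :
    AEMeasurable (approxJacobian f) (volume.restrict Ω) := by
  obtain ⟨B, hBm, -, hBΩ, hnull, hB⟩ := hf.exists_partition hΩ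
  have h1 : AEMeasurable (approxFDeriv f) (volume.restrict (⋃ j, B j)) :=
    aemeasurable_iUnion_iff.2 fun j => aemeasurable_fderivWithin volume (hBm j) (hB j)
  have h2 : (⋃ j, B j) =ᵐ[volume] Ω :=
    (iUnion_subset hBΩ).eventuallyLE.antisymm (ae_le_set.2 hnull)
  rw [Measure.restrict_congr_set h2] at h1
  exact ContinuousLinearMap.continuous_det.measurable.comp_aemeasurable h1

/-! ### Area inequalities -/

/-- Area inequality for maps satisfying the Lusin condition (N). -/
theorem LusinN.measure_image_le {n : ℕ} {f : Rn n → Rn n} {Ω E : Set (Rn n)} (hN : LusinN f Ω)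
    (hf : ApproxDifferentiableAE f Ω) (hΩ : MeasurableSet Ω) (hE : MeasurableSet E) (hEΩ : E ⊆ Ω) :
    volume (f '' E) ≤ ∫⁻ x in E, ‖approxJacobian f x‖ₑ := by
  obtain ⟨B, hBm, hdisj, hBΩ, hnull, hB⟩ := hf.exists_partition hΩ
  have hcov : f '' E ⊆ (f '' (E \ ⋃ j, B j)) ∪ ⋃ j, f '' (E ∩ B j) := by
    rw [← image_iUnion, ← image_union, ← inter_iUnion, sdiff_union_inter]
  -- Condition (N) disposes of the part missed by the pieces.
  have hz : volume (f '' (E \ ⋃ j, B j)) = 0 :=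
    hN _ (sdiff_subset.trans hEΩ) (measure_mono_null (sdiff_subset_sdiff_left hEΩ) hnull)
  calc volume (f '' E) ≤ volume (f '' (E \ ⋃ j, B j)) + volume (⋃ j, f '' (E ∩ B j)) :=
        (measure_mono hcov).trans (measure_union_le _ _)
    _ ≤ ∑' j, volume (f '' (E ∩ B j)) := by rw [hz, zero_add]; exact measure_iUnion_le _
    _ ≤ ∑' j, ∫⁻ x in E ∩ B j, ‖approxJacobian f x‖ₑ := by
        refine ENNReal.tsum_le_tsum fun j => ?_
        simp_rw [Real.enorm_eq_ofReal_abs]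
        exact addHaar_image_le_lintegral_abs_det_fderiv volume (hE.inter (hBm j))
          fun x hx => (hB j x hx.2).mono inter_subset_right
    _ = ∫⁻ x in ⋃ j, E ∩ B j, ‖approxJacobian f x‖ₑ :=
        (lintegral_iUnion (fun j => hE.inter (hBm j))
          (fun i j hij => (hdisj hij).mono inter_subset_right inter_subset_right) _).symm
    _ ≤ ∫⁻ x in E, ‖approxJacobian f x‖ₑ :=
        lintegral_mono_set (iUnion_subset fun j => inter_subset_left)

/-- Area inequality for maps that are injective a.e. -/
theorem InjectiveAE.lintegral_approxJacobian_le {n : ℕ} {f : Rn n → Rn n} {Ω E : Set (Rn n)}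
    (hinj : InjectiveAE f Ω) (hf : ApproxDifferentiableAE f Ω) (hΩ : MeasurableSet Ω)
    (hE : MeasurableSet E) (hEΩ : E ⊆ Ω) :
    ∫⁻ x in E, ‖approxJacobian f x‖ₑ ≤ volume (f '' E) := by
  obtain ⟨B, hBm, hdisj, hBΩ, hnull, hB⟩ := hf.exists_partition hΩ
  obtain ⟨N, -, hN0, hNinj⟩ := hinj
  -- `N` itself may fail to be Borel; removing its measurable hull keeps `D j` measurable.
  set D : ℕ → Set (Rn n) := fun j => (E ∩ B j) \ toMeasurable volume N with hD
  have hDm : ∀ j, MeasurableSet (D j) := fun j =>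
    (hE.inter (hBm j)).diff (measurableSet_toMeasurable _ _)
  have hDB : ∀ j, D j ⊆ B j := fun j => sdiff_subset.trans inter_subset_right
  have hDE : ∀ j, D j ⊆ E := fun j => sdiff_subset.trans inter_subset_left
  have hDdisj : Pairwise (Function.onFun Disjoint D) := fun i j hij =>
    (hdisj hij).mono (hDB i) (hDB j)
  have hDΩ : ∀ j, D j ⊆ Ω \ N := fun j x hx =>
    ⟨hEΩ (hDE j hx), fun h => hx.2 (subset_toMeasurable _ _ h)⟩
  have hDd : ∀ j, ∀ x ∈ D j, HasFDerivWithinAt f (approxFDeriv f x) (D j) x := fun j x hx =>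
    (hB j x (hDB j hx)).mono (hDB j)
  have hae : (⋃ j, D j) =ᵐ[volume] E := by
    refine (iUnion_subset hDE).eventuallyLE.antisymm (ae_le_set.2 ?_)
    refine measure_mono_null (t := (Ω \ ⋃ j, B j) ∪ toMeasurable volume N) ?_
      (measure_union_null hnull (by rwa [measure_toMeasurable]))
    rintro x ⟨hxE, hxD⟩
    by_cases hxN : x ∈ toMeasurable volume N
    · exact Or.inr hxN
    · refine Or.inl ⟨hEΩ hxE, fun hxB => hxD ?_⟩
      obtain ⟨j, hj⟩ := mem_iUnion.1 hxB
      exact mem_iUnion.2 ⟨j, ⟨hxE, hj⟩, hxN⟩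
  calc ∫⁻ x in E, ‖approxJacobian f x‖ₑ = ∫⁻ x in ⋃ j, D j, ‖approxJacobian f x‖ₑ := by
        rw [Measure.restrict_congr_set hae]
    _ = ∑' j, ∫⁻ x in D j, ‖approxJacobian f x‖ₑ := lintegral_iUnion hDm hDdisj _
    _ = ∑' j, volume (f '' D j) := by
        refine tsum_congr fun j => ?_
        simp_rw [Real.enorm_eq_ofReal_abs]
        exact lintegral_abs_det_fderiv_eq_addHaar_image volume (hDm j) (hDd j)
          (hNinj.mono (hDΩ j))
    _ = volume (⋃ j, f '' D j) := by
        refine (measure_iUnion (fun i j hij => ?_) fun j =>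
          measurable_image_of_fderivWithin (hDm j) (hDd j) (hNinj.mono (hDΩ j))).symm
        exact (hDdisj hij).image hNinj (hDΩ i) (hDΩ j)
    _ ≤ volume (f '' E) := measure_mono (iUnion_subset fun j => image_mono (hDE j))

/-! ### Scheffé's lemma and the main theorem -/

/-- A form of Scheffé's lemma: a.e. convergence, together with an asymptotic upper bound for the
`L¹` norms by the `L¹` norm of the limit, implies convergence in `L¹`. -/
theorem tendsto_lintegral_enorm_sub_of_tendsto_ae {α : Type*} [MeasurableSpace α] {μ : Measure α}
    {u : ℕ → α → ℝ} {v : α → ℝ} (hu : ∀ k, AEMeasurable (u k) μ) (hv : AEMeasurable v μ)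
    (hfin : ∫⁻ x, ‖v x‖ₑ ∂μ ≠ ∞) (hlim : ∀ᵐ x ∂μ, Tendsto (fun k => u k x) atTop (𝓝 (v x)))
    {b : ℕ → ℝ≥0∞} (hub : ∀ k, ∫⁻ x, ‖u k x‖ₑ ∂μ ≤ b k) {b' : ℝ≥0∞}
    (hb : Tendsto b atTop (𝓝 b')) (hb' : b' ≤ ∫⁻ x, ‖v x‖ₑ ∂μ) :
    Tendsto (fun k => ∫⁻ x, ‖u k x - v x‖ₑ ∂μ) atTop (𝓝 0) := by
  set c := ∫⁻ x, ‖v x‖ₑ ∂μ with hc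
  -- By the triangle inequality the subtraction is never truncated. Since `U k → 2|v|` a.e., Fatou
  -- bounds `liminf ∫ U k` below by `2c`, while `∫ U k + ∫ |u k - v| ≤ b k + c`.
  set U : ℕ → α → ℝ≥0∞ := fun k x => ‖u k x‖ₑ + ‖v x‖ₑ - ‖u k x - v x‖ₑ with hU
  have hUm : ∀ k, AEMeasurable (U k) μ := fun k =>
    ((hu k).enorm.add hv.enorm).sub ((hu k).sub hv).enorm
  have hfatou : c + c ≤ liminf (fun k => ∫⁻ x, U k x ∂μ) atTop := by
    refine le_trans (le_of_eq ?_) (lintegral_liminf_le' hUm)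
    rw [hc, ← lintegral_add_left' hv.enorm]
    refine lintegral_congr_ae ?_
    filter_upwards [hlim] with x hx
    have h1 : Tendsto (fun k => U k x) atTop (𝓝 (‖v x‖ₑ + ‖v x‖ₑ - ‖v x - v x‖ₑ)) :=
      ENNReal.Tendsto.sub ((hx.enorm).add tendsto_const_nhds) (hx.sub tendsto_const_nhds).enorm
        (Or.inl (by simp))
    simpa using h1.liminf_eq.symm
  have hsum : ∀ k, ∫⁻ x, U k x ∂μ + ∫⁻ x, ‖u k x - v x‖ₑ ∂μ ≤ b k + c := fun k => by
    rw [← lintegral_add_left' (hUm k)]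
    calc ∫⁻ x, (U k x + ‖u k x - v x‖ₑ) ∂μ = ∫⁻ x, (‖u k x‖ₑ + ‖v x‖ₑ) ∂μ :=
          lintegral_congr fun x => tsub_add_cancel_of_le enorm_sub_le
      _ = ∫⁻ x, ‖u k x‖ₑ ∂μ + c := lintegral_add_left' (hu k).enorm _
      _ ≤ b k + c := by gcongr; exact hub k
  refine ENNReal.tendsto_nhds_zero.2 fun ε hε => ?_
  rcases eq_or_ne ε ∞ with rfl | hεt
  · exact Eventually.of_forall fun _ => le_top
  have hε2 : ε / 2 ≠ 0 := (ENNReal.half_pos hε.ne').ne'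
  have hε2t : ε / 2 ≠ ∞ := (ENNReal.half_lt_self hε.ne' hεt).ne_top
  have hcc : c + c ≠ ∞ := ENNReal.add_ne_top.2 ⟨hfin, hfin⟩
  have hbe : ∀ᶠ k in atTop, b k ≤ c + ε / 2 :=
    (hb.eventually_lt_const (hb'.trans_lt (ENNReal.lt_add_right hfin hε2))).mono fun _ h => h.le
  have hUe : ∀ᶠ k in atTop, c + c ≤ ∫⁻ x, U k x ∂μ + ε / 2 := by
    rcases eq_or_ne (c + c) 0 with h0 | h0
    · simp [h0]
    · have := eventually_lt_of_lt_liminf ((ENNReal.sub_lt_self hcc h0 hε2).trans_le hfatou)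
      exact this.mono fun k hk => tsub_le_iff_right.1 hk.le
  filter_upwards [hbe, hUe] with k hk1 hk2
  refine (ENNReal.add_le_add_iff_left hcc).1 ?_
  calc c + c + ∫⁻ x, ‖u k x - v x‖ₑ ∂μ
      ≤ ∫⁻ x, U k x ∂μ + ε / 2 + ∫⁻ x, ‖u k x - v x‖ₑ ∂μ := by gcongr
    _ = (∫⁻ x, U k x ∂μ + ∫⁻ x, ‖u k x - v x‖ₑ ∂μ) + ε / 2 := by ring
    _ ≤ (b k + c) + ε / 2 := add_le_add_left (hsum k) _
    _ ≤ (c + ε / 2 + c) + ε / 2 := by gcongr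
    _ = c + c + (ε / 2 + ε / 2) := by ring
    _ = c + c + ε := by rw [ENNReal.add_halves]

theorem theorem1p3 (n : ℕ) (Ω : Set (Rn n))
    (hΩo : IsOpen Ω) (hΩc : IsConnected Ω) (hΩb : Bornology.IsBounded Ω)
    (f : ℕ → Rn n → Rn n) (g : Rn n → Rn n)
    (hf_cont : ∀ k, ContinuousOn (f k) Ω)
    (hf_inj : ∀ k, InjectiveAE (f k) Ω)
    (hf_diff : ∀ k, ApproxDifferentiableAE (f k) Ω)
    (hg_N : LusinN g Ω)
    (hg_diff : ApproxDifferentiableAE g Ω)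
    (hg_loc : LocallyIntegrableOn (approxJacobian g) Ω volume)
    (hconv : TendstoInMeasure (volume.restrict Ω) (fun k => approxFDeriv (f k)) atTop
      (approxFDeriv g))
    (himg : ∀ E : Set (Rn n), MeasurableSet E → CompactlyContained E Ω →
      Tendsto (fun k => volume (f k '' E)) atTop (𝓝 (volume (g '' E)))) :
    TendstoInL1Loc (fun k => approxJacobian (f k)) (approxJacobian g) Ω := by
  have hΩm := hΩo.measurableSet
  have hle : ∀ k (K : Set (Rn n)), K ⊆ Ω → IsCompact K →
      ∫⁻ x in K, ‖approxJacobian (f k) x‖ₑ ≤ volume (f k '' K) := fun k K hKΩ hK =>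
    (hf_inj k).lintegral_approxJacobian_le (hf_diff k) hΩm hK.measurableSet hKΩ
  have hmeas : ∀ k (K : Set (Rn n)), K ⊆ Ω →
      AEMeasurable (approxJacobian (f k)) (volume.restrict K) := fun k K hKΩ =>
    ((hf_diff k).aemeasurable_approxJacobian hΩm).mono_set hKΩ
  refine ⟨fun k => (locallyIntegrableOn_iff hΩo.isLocallyClosed).2 fun K hKΩ hK =>
    ⟨(hmeas k K hKΩ).aestronglyMeasurable, ?_⟩, hg_loc, fun K hKΩ hK => ?_⟩
  -- Continuity makes `f k '' K` compact, hence of finite measure.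
  · exact (hle k K hKΩ hK).trans_lt (hK.image_of_continuousOn ((hf_cont k).mono hKΩ)).measure_lt_top
  -- Convergence in measure gives a.e. convergence only along subsequences, so it is applied inside
  -- an arbitrary subsequence.
  · refine tendsto_of_subseq_tendsto fun ns hns => ?_
    obtain ⟨ms, hms, hae⟩ := (hconv.comp hns).exists_seq_tendsto_ae
    refine ⟨ms, tendsto_lintegral_enorm_sub_of_tendsto_ae (fun k => hmeas _ K hKΩ)
      ((hg_diff.aemeasurable_approxJacobian hΩm).mono_set hKΩ)
      (hg_loc.integrableOn_compact_subset hKΩ hK).2.ne ?_ (fun k => hle _ K hKΩ hK)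
      (((himg K hK.measurableSet ?_).comp hns).comp hms.tendsto_atTop)
      (hg_N.measure_image_le hg_diff hΩm hK.measurableSet hKΩ)⟩
    · filter_upwards [ae_restrict_of_ae_restrict_of_subset hKΩ hae] with x hx
      exact (ContinuousLinearMap.continuous_det.tendsto _).comp hx
    · rw [CompactlyContained, hK.isClosed.closure_eq]
      exact ⟨hK, hKΩ⟩
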